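/- A hemiring $R$ is a set with a commutative monoid structure $(R,+,0)$ and an associative multiplication (not necessarily with identity) that distributes over addition on both sides and satisfies $0r=r0=0$; a semiring is a hemiring with a multiplicative identity. Ideals are two-sided unless stated otherwise, and an ideal of a hemiring is regarded as a hemiring itself. For a hemiring $R$ and $n\ge 1$, let $M_n(R)$ be the hemiring of $n\times n$ matrices over $R$, and for $X\subseteq R$ let $M_n(X)\subseteq M_n(R)$ be the set of matrices with all entries in $X$. Define the following three radicals. - Brown-McCoy radical. A semiring is ideal-simple if its only ideals are $0$ and itself. Call a hemiring Brown-McCoy radical if no nonzero ideal-simple semiring is the image of it under a surjective hemiring homomorphism. Then $\mathcal{R}_{BM}(R)$ is the union of all ideals of $R$ that are Brown-McCoy radical hemirings. - $J_s$-radical. A left $R$-semimodule is a commutative monoid $(M,+,0)$ with a biadditive action $R\times M\to M$ such that $(rs)m=r(sm)$ and $r0=0=0m$. It is simple if $RM\ne 0$, its only subsemimodules are $0$ and $M$, and its only congruences are the diagonal and $M\times M$. Then $J_s(R)$ is the intersection of the annihilators $\{r\in R : rM=0\}$ over all simple left $R$-semimodules $M$ (and $J_s(R)=R$ if there are none). -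 Jacobson (Jacobson-Bourne) radical. A right ideal $I$ of $R$ is right semiregular if for all $i_1,i_2\in I$ there are $j_1,j_2\in I$ with $i_1+j_1+i_1j_1+i_2j_2=i_2+j_2+i_1j_2+i_2j_1$. Then $J(R)$ is the sum of all right semiregular right ideals of $R$. Then for every hemiring $R$ and every $n\ge 1$: (i) $\mathcal{R}_{BM}(M_n(R))=M_n(\mathcal{R}_{BM}(R))$; (ii) $J_s(M_n(R))=M_n(J_s(R))$; (iii) $J(M_n(R))=M_n(J(R))$. -/

import Mathlib

/-!
A hemiring (an additively commutative semiring with an absorbing zero and possibly without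
identity element) is Mathlib's `NonUnitalSemiring`; a semiring (a hemiring with identity element)
is Mathlib's `Semiring`.  The matrix hemiring `M_n(R)` is `Matrix (Fin n) (Fin n) R`, and for
`X ⊆ R` the set `M_n(X)` of all matrices with entries in `X` is `X.matrix`.
-/

namespace Hemiring

universe u v

/-! ### The Brown-McCoy radical -/

/-- A two-sided ideal of a hemiring: a subhemiring `I` with `R I ⊆ I` and `I R ⊆ I`.  As a
subhemiring, an ideal is itself a hemiring. -/
def IsIdeal {R : Type u} [NonUnitalSemiring R] (I : NonUnitalSubsemiring R) : Prop :=
  ∀ r : R, ∀ x ∈ I, r * x ∈ I ∧ x * r ∈ I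

/-- A hemiring is ideal-simple if its only two-sided ideals are zero and the whole hemiring. -/
def IsIdealSimple (R : Type u) [NonUnitalSemiring R] : Prop :=
  ∀ I : NonUnitalSubsemiring R, IsIdeal I → I = ⊥ ∨ I = ⊤

/-- `R` is a Brown-McCoy radical hemiring: it belongs to the upper radical of the class of
ideal-simple semirings, i.e. it has no nonzero homomorphic image which is an ideal-simple semiring
(with identity element).  Homomorphic images of `R` have representatives in the universe
of `R`. -/
def IsBrownMcCoyRadical (R : Type u) [NonUnitalSemiring R] : Prop :=
  ∀ (S : Type u) [Semiring S] [Nontrivial S], IsIdealSimple S →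
    ∀ f : R →ₙ+* S, ¬ Function.Surjective f

/-- The Brown-McCoy radical of `R`: the union of all ideals of `R` that are, as hemirings,
Brown-McCoy radical hemirings. -/
def brownMcCoyRadical (R : Type u) [NonUnitalSemiring R] : Set R :=
  {r | ∃ I : NonUnitalSubsemiring R, IsIdeal I ∧ IsBrownMcCoyRadical I ∧ r ∈ I}

/-! ### The radical `J_s` -/

/-- A left semimodule over a hemiring `R`. -/
class LeftSemimodule (R : Type u) (M : Type v) [NonUnitalSemiring R] [AddCommMonoid M]
    extends SMul R M where
  mul_smul : ∀ (r s : R) (m : M), (r * s) • m = r • (s • m)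
  smul_add : ∀ (r : R) (m m' : M), r • (m + m') = r • m + r • m'
  add_smul : ∀ (r s : R) (m : M), (r + s) • m = r • m + s • m
  smul_zero : ∀ r : R, r • (0 : M) = 0
  zero_smul : ∀ m : M, (0 : R) • m = 0

/-- A left semimodule `M` is simple if `R M ≠ 0`, its only subsemimodules are `0` and `M`, and its
only congruences are the diagonal and the universal one.  (If `R` has an identity element, then it
acts as the identity on every such `M`, so unitarity need not be required.) -/
structure IsSimpleSemimodule (R : Type u) (M : Type v) [NonUnitalSemiring R] [AddCommMonoid M]
    [LeftSemimodule R M] : Prop where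
  exists_smul_ne_zero : ∃ (r : R) (m : M), r • m ≠ 0
  subsemimodule_trivial : ∀ N : AddSubmonoid M,
    (∀ (r : R), ∀ m ∈ N, r • m ∈ N) → N = ⊥ ∨ N = ⊤
  congruence_trivial : ∀ c : AddCon M,
    (∀ (r : R) (m m' : M), c m m' → c (r • m) (r • m')) → c = ⊥ ∨ c = ⊤

/-- The radical `J_s(R)`: the intersection of the annihilators of all simple left
`R`-semimodules (all of `R` if there are none).  A simple semimodule `M` equals `R m` for every
nonzero `m` in `M`, so up to isomorphism each of them lives in the universe of `R`. -/
def simpleRadical (R : Type u) [NonUnitalSemiring R] : Set R :=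
  {r | ∀ (M : Type u) [AddCommMonoid M] [LeftSemimodule R M], IsSimpleSemimodule R M →
    ∀ m : M, r • m = 0}

/-! ### The Jacobson-Bourne radical -/

/-- A right ideal of a hemiring. -/
def IsRightIdeal {R : Type u} [NonUnitalSemiring R] (I : AddSubmonoid R) : Prop :=
  ∀ x ∈ I, ∀ r : R, x * r ∈ I

/-- Right semiregularity of a right ideal. -/
def IsRightSemiregular {R : Type u} [NonUnitalSemiring R] (I : AddSubmonoid R) : Prop :=
  ∀ i₁ ∈ I, ∀ i₂ ∈ I, ∃ j₁ ∈ I, ∃ j₂ ∈ I,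
    i₁ + j₁ + i₁ * j₁ + i₂ * j₂ = i₂ + j₂ + i₁ * j₂ + i₂ * j₁

/-- The Jacobson(-Bourne) radical `J(R)`: the sum of all right semiregular right ideals. -/
def jacobsonRadical (R : Type u) [NonUnitalSemiring R] : AddSubmonoid R :=
  sSup {I : AddSubmonoid R | IsRightIdeal I ∧ IsRightSemiregular I}

end Hemiring

namespace Hemiring

universe u v

/-! ### The Brown-McCoy radical of matrices -/

/-! Each equality is the classical transfer between `R` and `M_n(R)`. The obstacle is that `R` need
not have an identity, so matrix units are not elements of `M_n(R)` and have to be simulated.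

Brown-McCoy: a radical ideal maps to zero under every surjection onto a nonzero ideal-simple
semiring, so the radical is itself the largest radical ideal. Matrices over an ideal-simple semiring
are ideal-simple; hence the entries of a radical ideal of `M_n(R)` generate a radical ideal of `R`.
Conversely, if `M_n(A)` maps onto an ideal-simple semiring `S`, a preimage of `1` stands in for the
identity matrix, and a diagonal corner of `S` is an ideal-simple image of `A` with identity
(`isBrownMcCoyRadical_matrix`).

`J_s`: simple semimodules correspond, `M` over `R` giving the column vectors `M^n`, and `N` over
`M_n(R)` giving its corner at a diagonal position (`IsSimpleSemimodule.pi`,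
`IsSimpleSemimodule.corner`).

Jacobson: semiregularity says, up to additive cancellation, that `1 + (i₁ - i₂)` has right inverse
`1 + (j₁ - j₂)`. So `J(R)` is the preimage of the Jacobson radical of a ring of differences
(`IsDifferenceMap.mem_jacobsonRadical_iff`), and the known theorem for matrices over rings applies.
-/

theorem IsBrownMcCoyRadical.of_surjective {A B : Type u} [NonUnitalSemiring A]
    [NonUnitalSemiring B] (hA : IsBrownMcCoyRadical A) (f : A →ₙ+* B)
    (hf : Function.Surjective f) : IsBrownMcCoyRadical B :=
  fun S _ _ hS g hg => hA S hS (g.comp f) (hg.comp hf)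

/-- A homomorphism from a Brown-McCoy radical hemiring onto an ideal of a nonzero ideal-simple
semiring vanishes. -/
theorem IsBrownMcCoyRadical.map_eq_zero {L S : Type u} [NonUnitalSemiring L] [Semiring S]
    [Nontrivial S] (hL : IsBrownMcCoyRadical L) (hS : IsIdealSimple S) (g : L →ₙ+* S)
    (hg : ∀ s x, (∃ y, g y = s * g x) ∧ ∃ y, g y = g x * s) (x : L) : g x = 0 := by
  have key : IsIdeal (NonUnitalRingHom.srange g) := by
    rintro s _ ⟨x, rfl⟩
    exact hg s x
  rcases hS _ key with h | h
  · have hx : g x ∈ NonUnitalRingHom.srange g := ⟨x, rfl⟩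
    rw [h] at hx
    exact hx
  · exact absurd (NonUnitalRingHom.srange_eq_top_iff_surjective.mp h) (hL S hS g)

/-- The identity element of the target may be given as an element of a hemiring. -/
theorem not_isBrownMcCoyRadical {A T : Type u} [NonUnitalSemiring A] [NonUnitalSemiring T] (p : T)
    (hl : ∀ t, p * t = t) (hr : ∀ t, t * p = t) (hp : p ≠ 0) (hT : IsIdealSimple T)
    (g : A →ₙ+* T) (hg : Function.Surjective g) : ¬ IsBrownMcCoyRadical A := by
  intro hA
  let _ : Semiring T :=
    { (inferInstance : NonUnitalSemiring T) with
      one := p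
      one_mul := hl
      mul_one := hr }
  have : Nontrivial T := ⟨p, 0, hp⟩
  exact hA T hT g hg

/-- The ideal given by an additive submonoid that absorbs multiplication. -/
def idealOfAddSubmonoid {R : Type u} [NonUnitalSemiring R] (I : AddSubmonoid R)
    (hI : ∀ r : R, ∀ x ∈ I, r * x ∈ I ∧ x * r ∈ I) : NonUnitalSubsemiring R where
  __ := I
  mul_mem' {a b} _ hb := (hI a b hb).1

/-! ### The Brown-McCoy radical is a radical ideal. -/

section Ideal

variable {R : Type u} [NonUnitalSemiring R]

theorem mul_mem_closure {s : Set R} (hs : ∀ r : R, ∀ x ∈ s, r * x ∈ s ∧ x * r ∈ s) (r x : R)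
    (hx : x ∈ AddSubmonoid.closure s) :
    r * x ∈ AddSubmonoid.closure s ∧ x * r ∈ AddSubmonoid.closure s := by
  induction hx using AddSubmonoid.closure_induction with
  | mem x hx =>
    exact ⟨AddSubmonoid.subset_closure (hs r x hx).1, AddSubmonoid.subset_closure (hs r x hx).2⟩
  | zero => simp
  | add x y _ _ hx hy =>
    rw [mul_add, add_mul]
    exact ⟨add_mem hx.1 hy.1, add_mem hx.2 hy.2⟩

theorem mul_mem_brownMcCoyRadical (r x : R) (hx : x ∈ brownMcCoyRadical R) :
    r * x ∈ brownMcCoyRadical R ∧ x * r ∈ brownMcCoyRadical R := by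
  obtain ⟨I, hI, hrad, hxI⟩ := hx
  exact ⟨⟨I, hI, hrad, (hI r x hxI).1⟩, ⟨I, hI, hrad, (hI r x hxI).2⟩⟩

variable (R) in
/-- The largest Brown-McCoy radical ideal. -/
def brownMcCoyIdeal : NonUnitalSubsemiring R :=
  idealOfAddSubmonoid (AddSubmonoid.closure (brownMcCoyRadical R))
    (mul_mem_closure mul_mem_brownMcCoyRadical)

theorem isIdeal_brownMcCoyIdeal : IsIdeal (brownMcCoyIdeal R) :=
  mul_mem_closure mul_mem_brownMcCoyRadical

/-- A surjection onto an ideal-simple semiring kills each radical ideal, hence all sums of their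
elements, so it could not reach `1`. -/
theorem isBrownMcCoyRadical_brownMcCoyIdeal : IsBrownMcCoyRadical (brownMcCoyIdeal R) := by
  intro S _ _ hS f hf
  have hz : ∀ x (hx : x ∈ brownMcCoyIdeal R), f ⟨x, hx⟩ = 0 := by
    intro x hx
    induction hx using AddSubmonoid.closure_induction with
    | mem x hx =>
      obtain ⟨I, hI, hrad, hxI⟩ := hx
      have hle : I ≤ brownMcCoyIdeal R := fun y hy =>
        AddSubmonoid.subset_closure ⟨I, hI, hrad, hy⟩
      refine hrad.map_eq_zero hS (f.comp (NonUnitalSubsemiring.inclusion hle)) ?_ ⟨x, hxI⟩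
      intro s y
      obtain ⟨a, rfl⟩ := hf s
      refine ⟨⟨⟨a * y, (hI a y y.2).1⟩, ?_⟩, ⟨⟨y * a, (hI a y y.2).2⟩, ?_⟩⟩
      · exact map_mul f a (NonUnitalSubsemiring.inclusion hle y)
      · exact map_mul f (NonUnitalSubsemiring.inclusion hle y) a
    | zero => exact map_zero f
    | add x y hx hy ihx ihy =>
      have := map_add f ⟨x, hx⟩ ⟨y, hy⟩
      rw [ihx, ihy, add_zero] at this
      exact this
  obtain ⟨x, hx⟩ := hf 1
  exact one_ne_zero (hx.symm.trans (hz x x.2))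

theorem coe_brownMcCoyIdeal : (brownMcCoyIdeal R : Set R) = brownMcCoyRadical R :=
  Set.Subset.antisymm
    (fun _ hx => ⟨_, isIdeal_brownMcCoyIdeal, isBrownMcCoyRadical_brownMcCoyIdeal, hx⟩)
    (fun _ hx => AddSubmonoid.subset_closure hx)

end Ideal

/-- The homomorphism of matrix hemirings given by a homomorphism of hemirings. -/
def matrixMap (ι : Type*) [Fintype ι] {A B : Type*} [NonUnitalSemiring A] [NonUnitalSemiring B]
    (f : A →ₙ+* B) : Matrix ι ι A →ₙ+* Matrix ι ι B where
  toFun X := X.map f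
  map_mul' _ _ := Matrix.map_mul
  map_zero' := Matrix.map_zero _ (map_zero f)
  map_add' := Matrix.map_add _ (map_add f)

@[simp]
theorem matrixMap_apply (ι : Type*) [Fintype ι] {A B : Type*} [NonUnitalSemiring A]
    [NonUnitalSemiring B] (f : A →ₙ+* B) (X : Matrix ι ι A) (i j : ι) :
    matrixMap ι f X i j = f (X i j) := rfl

/-! ### Transfer of Brown-McCoy radical ideals to and from matrices. -/

section Matrix

open Matrix

variable {ι : Type} [Fintype ι] [DecidableEq ι]

/-- Since `S` has an identity, matrix units move any entry of a matrix in `I` to any position; thus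
`I` consists of all matrices over an ideal `K` of `S`. -/
theorem matrix_isIdealSimple {S : Type u} [Semiring S] (hS : IsIdealSimple S) :
    IsIdealSimple (Matrix ι ι S) := by
  intro I hI
  let K : AddSubmonoid S :=
    { carrier := {s | ∀ i j, single i j s ∈ I}
      zero_mem' := fun i j => by simp
      add_mem' := fun {a b} ha hb i j => by
        rw [single_add]; exact add_mem (ha i j) (hb i j) }
  have hK : ∀ r : S, ∀ x ∈ K, r * x ∈ K ∧ x * r ∈ K := by
    intro r x hx
    refine ⟨fun i j => ?_, fun i j => ?_⟩
    · have := (hI (single i i r) _ (hx i j)).1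
      rwa [single_mul_single_same] at this
    · have := (hI (single j j r) _ (hx i j)).2
      rwa [single_mul_single_same] at this
  have hentry : ∀ X ∈ I, ∀ i j, X i j ∈ K := by
    intro X hX i j k l
    have := (hI (single j l 1) _ (hI (single k i 1) X hX).1).2
    rwa [single_mul_mul_single, one_mul, mul_one] at this
  rcases hS (idealOfAddSubmonoid K hK) hK with h | h
  · left
    rw [eq_bot_iff]
    intro X hX
    have : X = 0 := by
      ext i j
      have := hentry X hX i j
      change X i j ∈ idealOfAddSubmonoid K hK at this
      rw [h] at this
      exact this
    rw [this]
    exact zero_mem _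
  · right
    rw [eq_top_iff]
    intro X _
    rw [matrix_eq_sum_single X]
    refine sum_mem fun i _ => sum_mem fun j _ => ?_
    have : X i j ∈ idealOfAddSubmonoid K hK := by rw [h]; trivial
    exact this i j

/-- A homomorphism onto a semiring turns the matrix units, acting as multipliers, into
multiplications. -/
theorem exists_map_single {A S : Type*} [NonUnitalSemiring A] [Semiring S]
    (f : Matrix ι ι A →ₙ+* S) {E : Matrix ι ι A} (hE : f E = 1) (i j k l : ι) :
    ∃ c d : S, ∀ Y : Matrix ι ι A, f (single i j (Y k l)) = c * f Y * d := by
  -- With formal matrix units `e`, these are `f (E e_{ik})` and `f (e_{lj} E)`. The products `E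
  -- e_{ik}` and `e_{lj} E` are genuine matrices over `A`, although `e_{ik}` and `e_{lj}` need not
  -- be.
  refine ⟨f (of fun a b => if b = k then E a i else 0),
    f (of fun a b => if a = l then E j b else 0), fun Y => ?_⟩
  rw [← map_mul, ← map_mul, ← one_mul (f (single i j _)), ← mul_one (_ * f (single i j _)), ← hE,
    ← map_mul, ← map_mul]
  congr 1
  ext a b
  simp [mul_apply, single_apply, ite_and, Finset.sum_ite_eq]

/-- A surjection of `M_n(A)` onto an ideal-simple `S` would make the image of `a ↦ f (single o o a)`
a nonzero ideal-simple semiring; its identity is the image of the `(o, o)` entry of any preimage of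
`1`. -/
theorem isBrownMcCoyRadical_matrix [Nonempty ι] {A : Type u} [NonUnitalSemiring A]
    (hA : IsBrownMcCoyRadical A) : IsBrownMcCoyRadical (Matrix ι ι A) := by
  intro S _ _ hS f hf
  obtain ⟨o⟩ := ‹Nonempty ι›
  let g : A →ₙ+* S :=
    { toFun := fun a => f (single o o a)
      map_mul' := fun a b => by rw [← map_mul, single_mul_single_same]
      map_zero' := by simp
      map_add' := fun a b => by rw [← map_add, single_add] }
  -- Stated for every preimage `E` of `1`, because a second preimage, with entries controlled by an
  -- ideal, is used at the end.
  have hone : ∀ E, f E = 1 → ∀ a, g (E o o) * g a = g a ∧ g a * g (E o o) = g a := by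
    intro E hE a
    obtain ⟨c, d, h⟩ := exists_map_single f hE o o o o
    rw [← map_mul, ← map_mul]
    have h₁ := h (E * single o o a)
    have h₂ := h (single o o a * E)
    have h₃ := h (single o o a)
    rw [map_mul, hE, one_mul, ← h₃] at h₁
    rw [map_mul, hE, mul_one, ← h₃] at h₂
    simp only [mul_single_apply_same, single_mul_apply_same, single_apply_same] at h₁ h₂
    exact ⟨h₁, h₂⟩
  obtain ⟨E, hE⟩ := hf 1
  have hp : g (E o o) ≠ 0 := by
    intro hp
    have hg0 : ∀ a, f (single o o a) = 0 := fun a => by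
      have := (hone E hE a).1
      rwa [hp, zero_mul, eq_comm] at this
    -- If one diagonal corner vanishes, every position does, since each is obtained from it by
    -- multiplying by some `c` and `d`; then `f = 0`.
    have hs : ∀ i j a, f (single i j a) = 0 := fun i j a => by
      obtain ⟨c, d, h⟩ := exists_map_single f hE i j o o
      have := h (single o o a)
      rwa [hg0, mul_zero, zero_mul, single_apply_same] at this
    apply one_ne_zero (α := S)
    rw [← hE, matrix_eq_sum_single E, map_sum]
    refine Finset.sum_eq_zero fun i _ => ?_
    rw [map_sum]
    exact Finset.sum_eq_zero fun j _ => hs i j _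
  let g' : A →ₙ+* NonUnitalRingHom.srange g := NonUnitalRingHom.srangeRestrict g
  have hg' : Function.Surjective g' := NonUnitalRingHom.srangeRestrict_surjective g
  refine not_isBrownMcCoyRadical (T := NonUnitalRingHom.srange g) ⟨g (E o o), E o o, rfl⟩
    ?_ ?_ ?_ ?_ g' hg' hA
  · rintro ⟨_, a, rfl⟩
    exact Subtype.ext (hone E hE a).1
  · rintro ⟨_, a, rfl⟩
    exact Subtype.ext (hone E hE a).2
  · exact fun h => hp (congrArg Subtype.val h)
  · intro K hK
    have hKg : ∀ a b : A, g' b ∈ K →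
        g' (a * b) ∈ K ∧ g' (b * a) ∈ K := fun a b hb => by
      rw [map_mul, map_mul]
      exact hK _ _ hb
    -- The ideal of `S` induced by `K`: images of matrices with entries over `K`. If it contains `1
    -- = f X`, then the identity `g (X o o)` of the corner lies in `K`.
    let K' : AddSubmonoid S :=
      { carrier := {s | ∃ X, f X = s ∧ ∀ i j, g' (X i j) ∈ K}
        zero_mem' := ⟨0, map_zero f, fun i j => by simp⟩
        add_mem' := by
          rintro _ _ ⟨X, rfl, hX⟩ ⟨Y, rfl, hY⟩
          refine ⟨X + Y, map_add f X Y, fun i j => ?_⟩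
          rw [Matrix.add_apply, map_add]
          exact add_mem (hX i j) (hY i j) }
    have hK' : ∀ r : S, ∀ x ∈ K', r * x ∈ K' ∧ x * r ∈ K' := by
      rintro r _ ⟨X, rfl, hX⟩
      obtain ⟨Y, rfl⟩ := hf r
      refine ⟨⟨Y * X, map_mul f Y X, fun i j => ?_⟩, ⟨X * Y, map_mul f X Y, fun i j => ?_⟩⟩
      · rw [mul_apply, map_sum]
        exact sum_mem fun k _ => (hKg _ _ (hX k j)).1
      · rw [mul_apply, map_sum]
        exact sum_mem fun k _ => (hKg _ _ (hX i k)).2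
    rcases hS (idealOfAddSubmonoid K' hK') hK' with h | h
    · left
      rw [eq_bot_iff]
      rintro ⟨_, a, rfl⟩ ha
      have : g a ∈ idealOfAddSubmonoid K' hK' := by
        refine ⟨single o o a, rfl, fun i j => ?_⟩
        rw [single_apply]
        split_ifs
        · exact ha
        · rw [map_zero]; exact zero_mem K
      rw [h] at this
      exact Subtype.ext this
    · right
      rw [eq_top_iff]
      rintro ⟨_, a, rfl⟩ -
      have : (1 : S) ∈ idealOfAddSubmonoid K' hK' := by rw [h]; trivial
      obtain ⟨X, hX, hXK⟩ := this
      have h₁ := (hKg a _ (hXK o o)).2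
      have h₂ : g' (X o o * a) = g' a :=
        Subtype.ext ((map_mul g _ _).trans (hone X hX a).1)
      rw [h₂] at h₁
      exact h₁

theorem brownMcCoyRadical_matrix [Nonempty ι] (R : Type u) [NonUnitalSemiring R] :
    brownMcCoyRadical (Matrix ι ι R) = (brownMcCoyRadical R).matrix := by
  apply Set.Subset.antisymm
  · rintro X ⟨L, hL, hrad, hXL⟩ i j
    let I : AddSubmonoid R := AddSubmonoid.closure {r | ∃ X ∈ L, ∃ i j, X i j = r}
    have hI : ∀ r : R, ∀ x ∈ I, r * x ∈ I ∧ x * r ∈ I := by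
      refine mul_mem_closure ?_
      rintro r _ ⟨X, hX, i, j, rfl⟩
      refine ⟨⟨_, (hL (single i i r) X hX).1, i, j, ?_⟩, ⟨_, (hL (single j j r) X hX).2, i, j, ?_⟩⟩
      · simp
      · simp
    have hmem : ∀ X ∈ L, ∀ i j, X i j ∈ idealOfAddSubmonoid I hI := fun X hX i j =>
      AddSubmonoid.subset_closure ⟨X, hX, i, j, rfl⟩
    refine ⟨idealOfAddSubmonoid I hI, hI, ?_, hmem X hXL i j⟩
    intro S _ _ hS f hf
    let e : L →ₙ+* Matrix ι ι (idealOfAddSubmonoid I hI) :=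
      { toFun := fun X => of fun i j => ⟨X.1 i j, hmem X X.2 i j⟩
        map_mul' := fun X Y => by
          ext i j
          simp [mul_apply]
        map_zero' := rfl
        map_add' := fun X Y => rfl }
    -- The entrywise image of `L` is an ideal of the matrices over `S`: a multiplier over `S` lifts
    -- to a matrix over `I`, hence over `R`, and `L` absorbs it.
    have hz := hrad.map_eq_zero (matrix_isIdealSimple (ι := ι) hS) ((matrixMap ι f).comp e) (by
      intro s X
      choose a ha using fun i j => hf (s i j)
      have hs : s = matrixMap ι f (of a) := by ext i j; exact (ha i j).symm
      refine ⟨⟨⟨_, (hL (of fun i j => (a i j : R)) X X.2).1⟩, ?_⟩,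
        ⟨⟨_, (hL (of fun i j => (a i j : R)) X X.2).2⟩, ?_⟩⟩
      · rw [hs, NonUnitalRingHom.comp_apply, NonUnitalRingHom.comp_apply, ← map_mul]
        refine congrArg (matrixMap ι f) ?_
        ext i j
        rw [mul_apply, AddSubmonoidClass.coe_finsetSum]
        rfl
      · rw [hs, NonUnitalRingHom.comp_apply, NonUnitalRingHom.comp_apply, ← map_mul]
        refine congrArg (matrixMap ι f) ?_
        ext i j
        rw [mul_apply, AddSubmonoidClass.coe_finsetSum]
        rfl)
    have hz' : ∀ x (hx : x ∈ idealOfAddSubmonoid I hI), f ⟨x, hx⟩ = 0 := by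
      intro x hx
      induction hx using AddSubmonoid.closure_induction with
      | mem x hx =>
        obtain ⟨X, hX, i, j, rfl⟩ := hx
        exact congrFun (congrFun (hz ⟨X, hX⟩) i) j
      | zero => exact map_zero f
      | add x y hx hy ihx ihy =>
        have := map_add f ⟨x, hx⟩ ⟨y, hy⟩
        rw [ihx, ihy, add_zero] at this
        exact this
    obtain ⟨x, hx⟩ := hf 1
    exact one_ne_zero (hx.symm.trans (hz' x x.2))
  · intro X hX
    let L : AddSubmonoid (Matrix ι ι R) := (brownMcCoyIdeal R).toAddSubmonoid.matrix
    have hL : ∀ Y : Matrix ι ι R, ∀ X ∈ L, Y * X ∈ L ∧ X * Y ∈ L := by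
      refine fun Y X hX => ⟨fun i j => ?_, fun i j => ?_⟩
      · rw [mul_apply]
        exact sum_mem fun k _ => (isIdeal_brownMcCoyIdeal (Y i k) _ (hX k j)).1
      · rw [mul_apply]
        exact sum_mem fun k _ => (isIdeal_brownMcCoyIdeal (Y k j) _ (hX i k)).2
    let e : Matrix ι ι (brownMcCoyIdeal R) →ₙ+* idealOfAddSubmonoid L hL :=
      { toFun := fun X => ⟨X.map (↑), fun i j => (X i j).2⟩
        map_mul' := fun X Y => by
          apply Subtype.ext
          ext i j
          simp [mul_apply]
        map_zero' := rfl
        map_add' := fun X Y => rfl }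
    refine ⟨idealOfAddSubmonoid L hL, hL,
      (isBrownMcCoyRadical_matrix isBrownMcCoyRadical_brownMcCoyIdeal).of_surjective e ?_, ?_⟩
    · rintro ⟨X, hX⟩
      exact ⟨of fun i j => ⟨X i j, hX i j⟩, rfl⟩
    · rw [← coe_brownMcCoyIdeal] at hX
      exact hX

end Matrix

/-! ### The radical `J_s` of matrices -/

section SimpleRadical

namespace LeftSemimodule

variable {R : Type u} {M : Type v} [NonUnitalSemiring R] [AddCommMonoid M] [LeftSemimodule R M]

theorem sum_smul {κ : Type*} (s : Finset κ) (f : κ → R) (m : M) :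
    (∑ i ∈ s, f i) • m = ∑ i ∈ s, f i • m :=
  map_sum (⟨⟨fun r : R => r • m, zero_smul m⟩, fun r s => add_smul r s m⟩ : R →+ M) f s

theorem smul_sum {κ : Type*} (s : Finset κ) (r : R) (f : κ → M) :
    r • (∑ i ∈ s, f i) = ∑ i ∈ s, r • f i :=
  map_sum (⟨⟨fun m : M => r • m, smul_zero r⟩, fun m m' => smul_add r m m'⟩ : M →+ M) f s

end LeftSemimodule

namespace IsSimpleSemimodule

variable {R : Type u} {M : Type v} [NonUnitalSemiring R] [AddCommMonoid M] [LeftSemimodule R M]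

/-- Having equal multiples is a congruence; it is not universal because `R M ≠ 0`, so it is the
diagonal. This replaces acting by an identity element. -/
theorem ext_smul (hM : IsSimpleSemimodule R M) {m m' : M} (h : ∀ r : R, r • m = r • m') :
    m = m' := by
  let c : AddCon M :=
    { r := fun m m' => ∀ r : R, r • m = r • m'
      iseqv := ⟨fun _ _ => rfl, fun h r => (h r).symm, fun h h' r => (h r).trans (h' r)⟩
      add' := fun h h' r => by
        rw [LeftSemimodule.smul_add, LeftSemimodule.smul_add, h, h'] }
  have hc : ∀ (r : R) (m m' : M), c m m' → c (r • m) (r • m') := fun r m m' h s => by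
    rw [← LeftSemimodule.mul_smul, ← LeftSemimodule.mul_smul, h]
  rcases hM.congruence_trivial c hc with h0 | h1
  · have : c m m' := h
    rw [h0] at this
    exact this
  · obtain ⟨r, x, hx⟩ := hM.exists_smul_ne_zero
    have : c x 0 := by rw [h1]; trivial
    exact absurd ((this r).trans (LeftSemimodule.smul_zero r)) hx

theorem exists_smul_eq (hM : IsSimpleSemimodule R M) {m : M} (hm : m ≠ 0) (m' : M) :
    ∃ r : R, r • m = m' := by
  let N : AddSubmonoid M :=
    { carrier := {x | ∃ r : R, r • m = x}
      zero_mem' := ⟨0, LeftSemimodule.zero_smul m⟩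
      add_mem' := by
        rintro _ _ ⟨r, rfl⟩ ⟨s, rfl⟩
        exact ⟨r + s, LeftSemimodule.add_smul r s m⟩ }
  have hN : ∀ (r : R), ∀ x ∈ N, r • x ∈ N := by
    rintro r _ ⟨s, rfl⟩
    exact ⟨r * s, LeftSemimodule.mul_smul r s m⟩
  rcases hM.subsemimodule_trivial N hN with h | h
  · refine absurd (hM.ext_smul fun r => ?_) hm
    have : r • m ∈ N := ⟨r, rfl⟩
    rw [h, AddSubmonoid.mem_bot] at this
    rw [this, LeftSemimodule.smul_zero]
  · have : m' ∈ N := by rw [h]; trivial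
    exact this

end IsSimpleSemimodule

open Matrix

variable {ι : Type} [Fintype ι] {R : Type u} [NonUnitalSemiring R]

/-- Column vectors over a semimodule form a semimodule over the matrix hemiring. -/
instance piLeftSemimodule {M : Type v} [AddCommMonoid M] [LeftSemimodule R M] :
    LeftSemimodule (Matrix ι ι R) (ι → M) where
  smul X v i := ∑ j, X i j • v j
  mul_smul X Y v := by
    ext i
    change ∑ j, (X * Y) i j • v j = ∑ k, X i k • ∑ j, Y k j • v j
    simp_rw [mul_apply, LeftSemimodule.sum_smul, LeftSemimodule.smul_sum,
      LeftSemimodule.mul_smul]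
    exact Finset.sum_comm
  smul_add X v w := by
    ext i
    change ∑ j, X i j • (v j + w j) = ∑ j, X i j • v j + ∑ j, X i j • w j
    simp_rw [LeftSemimodule.smul_add, Finset.sum_add_distrib]
  add_smul X Y v := by
    ext i
    change ∑ j, (X i j + Y i j) • v j = ∑ j, X i j • v j + ∑ j, Y i j • v j
    simp_rw [LeftSemimodule.add_smul, Finset.sum_add_distrib]
  smul_zero X := by
    ext i
    exact Finset.sum_eq_zero fun j _ => LeftSemimodule.smul_zero _
  zero_smul v := by
    ext i
    exact Finset.sum_eq_zero fun j _ => LeftSemimodule.zero_smul _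

theorem matrix_smul_apply {M : Type v} [AddCommMonoid M] [LeftSemimodule R M] (X : Matrix ι ι R)
    (v : ι → M) (i : ι) : (X • v) i = ∑ j, X i j • v j := rfl

variable [DecidableEq ι]

theorem single_smul_eq {M : Type v} [AddCommMonoid M] [LeftSemimodule R M] (i j : ι) (r : R)
    (v : ι → M) : (single i j r : Matrix ι ι R) • v = Pi.single i (r • v j) := by
  ext k
  rw [matrix_smul_apply, Finset.sum_eq_single j]
  · by_cases h : i = k
    · subst h; simp
    · rw [single_apply_of_row_ne h, LeftSemimodule.zero_smul, Pi.single_eq_of_ne (Ne.symm h)]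
  · intro b _ hb
    rw [single_apply_of_col_ne _ _ (Ne.symm hb), LeftSemimodule.zero_smul]
  · exact fun h => absurd (Finset.mem_univ _) h

theorem matrix_smul_single {M : Type v} [AddCommMonoid M] [LeftSemimodule R M]
    (X : Matrix ι ι R) (i j : ι) (m : M) : (X • (Pi.single j m : ι → M)) i = X i j • m := by
  rw [matrix_smul_apply, Finset.sum_eq_single j]
  · simp
  · intro b _ hb
    rw [Pi.single_eq_of_ne hb, LeftSemimodule.smul_zero]
  · exact fun h => absurd (Finset.mem_univ _) h

/-- A nonzero coordinate generates `M`, and single-entry matrices place its multiples anywhere. A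
congruence is determined by what it does to vectors supported at one position. -/
theorem IsSimpleSemimodule.pi [Nonempty ι] {M : Type v} [AddCommMonoid M] [LeftSemimodule R M]
    (hM : IsSimpleSemimodule R M) : IsSimpleSemimodule (Matrix ι ι R) (ι → M) where
  exists_smul_ne_zero := by
    obtain ⟨r, m, h⟩ := hM.exists_smul_ne_zero
    obtain ⟨o⟩ := ‹Nonempty ι›
    refine ⟨single o o r, fun _ => m, fun h0 => h ?_⟩
    have := congrFun h0 o
    rwa [single_smul_eq, Pi.single_eq_same] at this
  subsemimodule_trivial N hN := by
    by_cases h : ∃ v ∈ N, v ≠ 0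
    · right
      obtain ⟨v, hv, hv0⟩ := h
      obtain ⟨j, hj⟩ := Function.ne_iff.mp hv0
      rw [eq_top_iff]
      intro w _
      rw [← Finset.univ_sum_single w]
      refine sum_mem fun i _ => ?_
      obtain ⟨r, hr⟩ := hM.exists_smul_eq hj (w i)
      have := hN (single i j r) v hv
      rwa [single_smul_eq, hr] at this
    · left
      push Not at h
      rw [eq_bot_iff]
      exact fun v hv => h v hv
  congruence_trivial c hc := by
    let d : AddCon M :=
      { r := fun m m' => ∀ i, c (Pi.single i m) (Pi.single i m')
        iseqv := ⟨fun _ _ => c.refl _, fun h i => c.symm (h i),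
          fun h h' i => c.trans (h i) (h' i)⟩
        add' := fun h h' i => by
          rw [Pi.single_add, Pi.single_add]
          exact c.add (h i) (h' i) }
    have hd : ∀ (r : R) (m m' : M), d m m' → d (r • m) (r • m') := by
      intro r m m' h i
      have := hc (single i i r) _ _ (h i)
      rwa [single_smul_eq, single_smul_eq, Pi.single_eq_same, Pi.single_eq_same] at this
    rcases hM.congruence_trivial d hd with h | h
    · left
      rw [eq_bot_iff]
      intro v w hvw
      change v = w
      ext j
      refine hM.ext_smul fun r => ?_
      have : d (r • v j) (r • w j) := fun i => by
        have := hc (single i j r) _ _ hvw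
        rwa [single_smul_eq, single_smul_eq] at this
      rw [h] at this
      exact this
    · right
      rw [eq_top_iff]
      intro v w _
      rw [← Finset.univ_sum_single v, ← Finset.univ_sum_single w]
      refine c.finsetSum _ fun i _ => ?_
      have : d (v i) (w i) := by rw [h]; trivial
      exact this i

/-- The matrix with row `o` equal to `v` and all other rows zero. -/
def rowMatrix (o : ι) (v : ι → R) : Matrix ι ι R := of fun a b => if a = o then v b else 0

theorem rowMatrix_mul (o : ι) (v : ι → R) (X : Matrix ι ι R) :
    rowMatrix o v * X = rowMatrix o (v ᵥ* X) := by
  ext a b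
  by_cases h : a = o <;> simp [rowMatrix, mul_apply, vecMul, dotProduct, h]

theorem single_mul_eq_rowMatrix (o j : ι) (r : R) (X : Matrix ι ι R) :
    single o j r * X = rowMatrix o fun b => r * X j b := by
  ext a b
  by_cases h : a = o
  · subst h; simp [rowMatrix]
  · simp [rowMatrix, h]

/-! ### Corners of semimodules over a matrix hemiring. -/

variable {N : Type v} [AddCommMonoid N] [LeftSemimodule (Matrix ι ι R) N]

variable (R N) in
/-- The part of a semimodule over a matrix hemiring on which the idempotent matrix unit at `o`
acts as the identity. -/
def corner (o : ι) : AddSubmonoid N where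
  carrier := {m | ∀ Y : Matrix ι ι R, Y • m = (of fun a b => if b = o then Y a b else 0) • m}
  zero_mem' Y := by rw [LeftSemimodule.smul_zero, LeftSemimodule.smul_zero]
  add_mem' h h' Y := by rw [LeftSemimodule.smul_add, LeftSemimodule.smul_add, h, h']

theorem rowMatrix_smul_mem (o : ι) (v : ι → R) (w : N) : rowMatrix o v • w ∈ corner R N o := by
  intro Y
  rw [← LeftSemimodule.mul_smul, ← LeftSemimodule.mul_smul]
  congr 1
  ext a b
  simp [rowMatrix, mul_apply]

omit [Fintype ι] in
theorem single_eq_rowMatrix (o j : ι) (r : R) : single o j r = rowMatrix o (Pi.single j r) := by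
  ext a b
  simp [rowMatrix, single_apply, Pi.single_apply, ite_and, eq_comm]

theorem rowMatrix_smul_of_mem {o : ι} {m : N} (hm : m ∈ corner R N o) (v : ι → R) :
    rowMatrix o v • m = single o o (v o) • m := by
  rw [hm]
  congr 1
  ext a b
  by_cases h : b = o
  · subst h
    simp [rowMatrix, single_apply, eq_comm]
  · simp [rowMatrix, h, Ne.symm h]

instance cornerLeftSemimodule (o : ι) : LeftSemimodule R (corner R N o) where
  smul r m := ⟨single o o r • (m : N), by
    rw [single_eq_rowMatrix]; exact rowMatrix_smul_mem o _ _⟩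
  mul_smul r s m := Subtype.ext <| by
    change single o o (r * s) • (m : N) = single o o r • single o o s • (m : N)
    rw [← LeftSemimodule.mul_smul, single_mul_single_same]
  smul_add r m m' := Subtype.ext (LeftSemimodule.smul_add _ _ _)
  add_smul r s m := Subtype.ext <| by
    change single o o (r + s) • (m : N) = single o o r • (m : N) + single o o s • (m : N)
    rw [single_add, LeftSemimodule.add_smul]
  smul_zero r := Subtype.ext (LeftSemimodule.smul_zero _)
  zero_smul m := Subtype.ext <| by
    change single o o (0 : R) • (m : N) = 0
    rw [single_zero, LeftSemimodule.zero_smul]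

theorem coe_corner_smul {o : ι} (r : R) (m : corner R N o) :
    ((r • m : corner R N o) : N) = (single o o r : Matrix ι ι R) • (m : N) := rfl

namespace IsSimpleSemimodule

variable (hN : IsSimpleSemimodule (Matrix ι ι R) N)
include hN

/-- Row matrices alone need not span `M_n(R)` under left multiplication, but every product `Y X` is
a sum of multiples of the row matrices of the rows of `X`. This is why `ext_smul` is applied twice.
-/
theorem ext_rowMatrix (o : ι) {w w' : N}
    (h : ∀ v : ι → R, rowMatrix o v • w = rowMatrix o v • w') : w = w' := by
  refine hN.ext_smul fun X => hN.ext_smul fun Y => ?_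
  have hYX : Y * X = ∑ j, (of fun a b => if b = o then Y a j else 0) * rowMatrix o (X j) := by
    ext a b
    simp [rowMatrix, mul_apply, Matrix.sum_apply]
  rw [← LeftSemimodule.mul_smul, ← LeftSemimodule.mul_smul, hYX, LeftSemimodule.sum_smul,
    LeftSemimodule.sum_smul]
  simp_rw [LeftSemimodule.mul_smul, h]

theorem ext_corner {o : ι} {m m' : corner R N o} (h : ∀ r : R, r • m = r • m') : m = m' := by
  refine Subtype.ext (hN.ext_rowMatrix o fun v => ?_)
  rw [rowMatrix_smul_of_mem m.2, rowMatrix_smul_of_mem m'.2]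
  exact congrArg Subtype.val (h (v o))

/-- If `Y m = m'` with both in the corner, only the `(o, o)` entry of `Y` matters. -/
theorem exists_corner_smul_eq {o : ι} {m : corner R N o} (hm : m ≠ 0) (m' : corner R N o) :
    ∃ r : R, r • m = m' := by
  obtain ⟨Y, hY⟩ := hN.exists_smul_eq (m := (m : N)) (fun h => hm (Subtype.ext h)) m'
  refine ⟨Y o o, hN.ext_corner fun r => ?_⟩
  rw [← LeftSemimodule.mul_smul]
  apply Subtype.ext
  rw [coe_corner_smul, coe_corner_smul, ← hY, ← LeftSemimodule.mul_smul,
    single_mul_eq_rowMatrix, rowMatrix_smul_of_mem m.2]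

theorem corner (o : ι) : IsSimpleSemimodule R (corner R N o) where
  exists_smul_ne_zero := by
    by_contra! h
    obtain ⟨X, w, hw⟩ := hN.exists_smul_ne_zero
    have h0 : ∀ m : Hemiring.corner R N o, m = 0 := fun m => hN.ext_corner fun r => by
      rw [h, h]
    refine hw (hN.ext_rowMatrix o fun v => ?_)
    rw [LeftSemimodule.smul_zero]
    exact congrArg Subtype.val (h0 ⟨_, rowMatrix_smul_mem o v (X • w)⟩)
  subsemimodule_trivial P hP := by
    by_cases h : ∃ m ∈ P, m ≠ 0
    · right
      obtain ⟨m, hm, hm0⟩ := h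
      rw [eq_top_iff]
      intro m' _
      obtain ⟨r, rfl⟩ := hN.exists_corner_smul_eq hm0 m'
      exact hP r m hm
    · left
      push Not at h
      rw [eq_bot_iff]
      exact fun v hv => h v hv
  congruence_trivial c hc := by
    -- The congruence on `N` induced by `c`: compare all compressions of two elements to the corner.
    let d : AddCon N :=
      { r := fun w w' => ∀ v : ι → R,
          c ⟨rowMatrix o v • w, rowMatrix_smul_mem o v w⟩
            ⟨rowMatrix o v • w', rowMatrix_smul_mem o v w'⟩
        iseqv := ⟨fun _ _ => c.refl _, fun h i => c.symm (h i),
          fun h h' i => c.trans (h i) (h' i)⟩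
        add' := fun h h' v => by
          simp_rw [LeftSemimodule.smul_add]
          exact c.add (h v) (h' v) }
    have hd : ∀ (X : Matrix ι ι R) (w w' : N), d w w' → d (X • w) (X • w') := by
      intro X w w' h v
      simp_rw [← LeftSemimodule.mul_smul, rowMatrix_mul]
      exact h _
    have hrow : ∀ (m : Hemiring.corner R N o) (v : ι → R),
        (⟨rowMatrix o v • (m : N), rowMatrix_smul_mem o v (m : N)⟩ : Hemiring.corner R N o) =
          v o • m := fun m v => Subtype.ext (rowMatrix_smul_of_mem m.2 v)
    rcases hN.congruence_trivial d hd with h | h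
    · left
      rw [eq_bot_iff]
      intro m m' hm
      have : d (m : N) (m' : N) := fun v => by
        rw [hrow, hrow]
        exact hc _ _ _ hm
      rw [h] at this
      exact Subtype.ext this
    · right
      have hz : ∀ m, c m 0 := by
        intro m
        by_cases hm : m = 0
        · rw [hm]; exact c.refl 0
        -- Choosing `r` with `r m = m` recovers `m` itself from its compressions.
        obtain ⟨r, hr⟩ := hN.exists_corner_smul_eq hm m
        have : d (m : N) ((0 : Hemiring.corner R N o) : N) := by rw [h]; trivial
        have := this fun _ => r
        rwa [hrow, hrow, hr, LeftSemimodule.smul_zero] at this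
      rw [eq_top_iff]
      exact fun m m' _ => c.trans (hz m) (c.symm (hz m'))

end IsSimpleSemimodule

theorem simpleRadical_matrix [Nonempty ι] (R : Type u) [NonUnitalSemiring R] :
    simpleRadical (Matrix ι ι R) = (simpleRadical R).matrix := by
  apply Set.Subset.antisymm
  · intro X hX i j M _ _ hM m
    have := congrFun (hX (ι → M) hM.pi (Pi.single j m)) i
    rwa [matrix_smul_single] at this
  · intro X hX N _ _ hN w
    obtain ⟨o⟩ := ‹Nonempty ι›
    by_cases hw : w = 0
    · rw [hw, LeftSemimodule.smul_zero]
    -- `Z` fixes `w` and so acts as a local identity: in `X w = X Z w` the entries of `X` act on the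
    -- elements `rowMatrix o (Z j) • w` of the corner, where they vanish.
    obtain ⟨Z, hZ⟩ := hN.exists_smul_eq hw w
    have hzero : ∀ k j, single o o (X k j) • rowMatrix o (Z j) • w = 0 := fun k j =>
      congrArg Subtype.val (hX k j _ (hN.corner o) ⟨_, rowMatrix_smul_mem o (Z j) w⟩)
    refine hN.ext_rowMatrix o fun v => ?_
    have hsum : rowMatrix o v * (X * Z) =
        ∑ k, ∑ j, single o o (v k) * (single o o (X k j) * rowMatrix o (Z j)) := by
      ext a b
      by_cases h : a = o
      · subst h
        simp [rowMatrix, mul_apply, Matrix.sum_apply, single_apply, Finset.mul_sum]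
      · simp [rowMatrix, mul_apply, Matrix.sum_apply, single_apply, h, Ne.symm h]
    rw [← hZ, ← LeftSemimodule.mul_smul X, ← LeftSemimodule.mul_smul, hsum,
      LeftSemimodule.smul_zero, LeftSemimodule.sum_smul]
    refine Finset.sum_eq_zero fun k _ => ?_
    rw [LeftSemimodule.sum_smul]
    refine Finset.sum_eq_zero fun j _ => ?_
    rw [LeftSemimodule.mul_smul, LeftSemimodule.mul_smul, hzero, LeftSemimodule.smul_zero]

end SimpleRadical

/-! ### The Jacobson-Bourne radical of matrices -/

/-! ### The Jacobson radical of a ring via one-sided inverses. -/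

section Ring

variable {B : Type v} [Ring B]

/-- A right inverse `u` of `1 + x b` equals `1 - x b u`, which has the same shape and so has a right
inverse too; thus `u` is a two-sided inverse. -/
theorem isUnit_one_add_mul_of_forall {x : B} (h : ∀ b, ∃ u, (1 + x * b) * u = 1) (b : B) :
    IsUnit (1 + x * b) := by
  obtain ⟨u, hu⟩ := h b
  obtain ⟨w, hw⟩ := h (-(b * u))
  have hu' : 1 + x * -(b * u) = u := by
    rw [mul_neg, ← mul_assoc, ← hu, add_mul, one_mul]
    abel
  rw [hu'] at hw
  have : 1 + x * b = w := by
    simpa [← mul_assoc, hu] using (congrArg ((1 + x * b) * ·) hw).symm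
  exact ⟨⟨1 + x * b, u, hu, by rw [this, hw]⟩, rfl⟩

theorem mem_jacobson_bot_iff {x : B} :
    x ∈ (⊥ : TwoSidedIdeal B).jacobson ↔ ∀ b, ∃ u, (1 + x * b) * u = 1 := by
  have key : ∀ y ∈ (⊥ : TwoSidedIdeal B).jacobson, ∃ z, z * (1 + y) = 1 := by
    intro y hy
    obtain ⟨z, hz⟩ := TwoSidedIdeal.mem_jacobson_iff.mp hy 1
    rw [TwoSidedIdeal.mem_bot, mul_one, sub_eq_zero] at hz
    exact ⟨z, by rw [mul_add, mul_one, add_comm, hz]⟩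
  constructor
  · intro hx b
    have hxb := TwoSidedIdeal.mul_mem_right _ x b hx
    obtain ⟨z, hz⟩ := key _ hxb
    obtain ⟨w, hw⟩ := key _ (TwoSidedIdeal.neg_mem _ (TwoSidedIdeal.mul_mem_left _ z _ hxb))
    have hz' : 1 + -(z * (x * b)) = z := by
      rw [← hz, mul_add, mul_one]
      abel
    rw [hz'] at hw
    have : 1 + x * b = w := by
      simpa [mul_assoc, hz] using (congrArg (· * (1 + x * b)) hw).symm
    exact ⟨z, by rw [this, hw]⟩
  · intro h
    rw [TwoSidedIdeal.mem_jacobson_iff]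
    intro y
    obtain ⟨u, -, hu⟩ := isUnit_iff_exists.mp (isUnit_one_add_mul_of_forall h y)
    -- If `u` inverts `1 + x y`, then `1 - y u x` inverts `1 + y x`.
    refine ⟨1 - y * u * x, ?_⟩
    rw [TwoSidedIdeal.mem_bot]
    calc (1 - y * u * x) * y * x + (1 - y * u * x) - 1
        = y * x - y * (u * (1 + x * y)) * x := by noncomm_ring
      _ = 0 := by rw [hu, mul_one, sub_self]

end Ring

/-- A homomorphism from a hemiring to a ring which identifies two elements only if they become
equal after adding some element, and such that the differences of elements of its image form a
two-sided ideal. -/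
structure IsDifferenceMap {R : Type u} {B : Type v} [NonUnitalSemiring R] [Ring B]
    (φ : R →ₙ+* B) : Prop where
  exists_add_eq : ∀ r s, φ r = φ s → ∃ k, r + k = s + k
  exists_mul_eq : ∀ r b, ∃ s t, φ r * b = φ s - φ t
  exists_mul_eq' : ∀ r b, ∃ s t, b * φ r = φ s - φ t

/-! ### The Jacobson-Bourne radical as a preimage of a ring radical. -/

namespace IsDifferenceMap

variable {R : Type u} {B : Type v} [NonUnitalSemiring R] [Ring B] {φ : R →ₙ+* B}

theorem exists_sub_mul_eq (h : IsDifferenceMap φ) (r r' : R) (b : B) :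
    ∃ s t, (φ r - φ r') * b = φ s - φ t := by
  obtain ⟨s, t, hst⟩ := h.exists_mul_eq r b
  obtain ⟨s', t', hst'⟩ := h.exists_mul_eq r' b
  refine ⟨s + t', t + s', ?_⟩
  rw [sub_mul, hst, hst', map_add, map_add]
  abel

theorem isRightSemiregular_iff_of_map (a₁ a₂ b₁ b₂ : R) :
    φ (a₁ + b₁ + a₁ * b₁ + a₂ * b₂) = φ (a₂ + b₂ + a₁ * b₂ + a₂ * b₁) ↔
      (1 + (φ a₁ - φ a₂)) * (1 + (φ b₁ - φ b₂)) = 1 := by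
  rw [← sub_eq_zero, ← sub_eq_zero (b := (1 : B))]
  simp only [map_add, map_mul]
  refine Eq.congr_left ?_
  noncomm_ring

theorem map_mem_jacobson (h : IsDifferenceMap φ) {I : AddSubmonoid R} (hI : IsRightIdeal I)
    (hI' : IsRightSemiregular I) {r : R} (hr : r ∈ I) :
    φ r ∈ (⊥ : TwoSidedIdeal B).jacobson := by
  rw [mem_jacobson_bot_iff]
  intro b
  -- The factor `b` need not come from `R`, so `φ r * b` need not be a difference of images from
  -- `I`. Multiplying `1 + φ r * b` by `1 - φ r * b` leaves `1 - φ r * (b * φ r * b)`, where the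
  -- bracket is a difference of images from `R`; semiregularity of `I` then applies.
  obtain ⟨s, t, hst⟩ := h.exists_mul_eq' r b
  obtain ⟨s', t', hst'⟩ := h.exists_sub_mul_eq s t b
  obtain ⟨j₁, -, j₂, -, hj⟩ := hI' _ (hI r hr t') _ (hI r hr s')
  have := (isRightSemiregular_iff_of_map (φ := φ) _ _ _ _).mp (congrArg φ hj)
  refine ⟨(1 - φ r * b) * (1 + (φ j₁ - φ j₂)), ?_⟩
  rw [← mul_assoc]
  refine (congrArg (· * (1 + (φ j₁ - φ j₂))) ?_).trans this
  calc (1 + φ r * b) * (1 - φ r * b) = 1 - φ r * (b * φ r * b) := by noncomm_ring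
    _ = 1 + (φ (r * t') - φ (r * s')) := by
      rw [hst, hst', map_mul, map_mul]
      noncomm_ring

theorem isRightSemiregular (h : IsDifferenceMap φ) {K : AddSubmonoid R} (hK : IsRightIdeal K)
    (hK' : ∀ r ∈ K, φ r ∈ (⊥ : TwoSidedIdeal B).jacobson) : IsRightSemiregular K := by
  intro i₁ h₁ i₂ h₂
  obtain ⟨c, hc⟩ := mem_jacobson_bot_iff.mp
    (TwoSidedIdeal.sub_mem _ (hK' i₁ h₁) (hK' i₂ h₂)) 1
  rw [mul_one] at hc
  -- The right inverse satisfies `c = 1 + (φ i₂ - φ i₁) c`, so `c - 1` is a difference of images.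
  obtain ⟨s, t, hst⟩ := h.exists_sub_mul_eq i₂ i₁ c
  have hc' : c = 1 + (φ s - φ t) := by
    rw [← hst, ← hc]
    noncomm_ring
  rw [hc', ← isRightSemiregular_iff_of_map] at hc
  obtain ⟨k, hk⟩ := h.exists_add_eq _ _ hc
  -- replace `(s, t)` by elements of `K`, and absorb `k` by adding `(i₁ + i₂) k` to both of them
  have hi := add_mem h₁ h₂
  refine ⟨i₂ + i₁ * t + i₂ * s + (i₁ + i₂) * k,
    add_mem (add_mem (add_mem h₂ (hK _ h₁ t)) (hK _ h₂ s)) (hK _ hi k),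
    i₁ + i₁ * s + i₂ * t + (i₁ + i₂) * k,
    add_mem (add_mem (add_mem h₁ (hK _ h₁ s)) (hK _ h₂ t)) (hK _ hi k), ?_⟩
  -- The left side of the goal contains `i₁` times the right side of `hk` plus `i₂` times its left
  -- side. Exchanging the sides of `hk` in both terms yields the right side of the goal, with no
  -- cancellation.
  have e₁ := congrArg (i₁ * ·) hk
  have e₂ := congrArg (i₂ * ·) hk
  beta_reduce at e₁ e₂
  calc
    _ = i₁ + i₂ + i₁ * (i₂ + t + i₁ * t + i₂ * s + k) + i₂ * (i₁ + s + i₁ * s + i₂ * t + k) +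
        (i₁ * ((i₁ + i₂) * k) + i₂ * ((i₁ + i₂) * k)) := by
      simp only [mul_add, add_mul]
      abel
    _ = _ := by
      rw [← e₁, e₂]
      simp only [mul_add, add_mul]
      abel

theorem mem_jacobsonRadical_iff (h : IsDifferenceMap φ) {r : R} :
    r ∈ jacobsonRadical R ↔ φ r ∈ (⊥ : TwoSidedIdeal B).jacobson := by
  let K : AddSubmonoid R :=
    { carrier := {r | φ r ∈ (⊥ : TwoSidedIdeal B).jacobson}
      zero_mem' := by
        rw [Set.mem_ofPred, map_zero]
        exact TwoSidedIdeal.zero_mem _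
      add_mem' := fun {a b} ha hb => by
        rw [Set.mem_ofPred, map_add]
        exact TwoSidedIdeal.add_mem _ ha hb }
  have hK : IsRightIdeal K := fun x hx r => by
    change φ (x * r) ∈ (⊥ : TwoSidedIdeal B).jacobson
    rw [map_mul]
    exact TwoSidedIdeal.mul_mem_right _ _ _ hx
  constructor
  · intro hr
    have : jacobsonRadical R ≤ K :=
      sSup_le fun I hI x hx => h.map_mem_jacobson hI.1 hI.2 hx
    exact this hr
  · intro hr
    have : K ≤ jacobsonRadical R := le_sSup ⟨hK, h.isRightSemiregular hK fun _ h => h⟩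
    exact this hr

end IsDifferenceMap

/-! ### Construction of the ring of differences. -/

section DifferenceRing

open Algebra

variable (S : Type u) [Semiring S]

theorem grothendieckAddGroup_hom_ext {M G : Type*} [AddCommMonoid M] [AddCommGroup G]
    {f g : GrothendieckAddGroup M →+ G}
    (h : ∀ m, f (GrothendieckAddGroup.of m) = g (GrothendieckAddGroup.of m)) : f = g :=
  GrothendieckAddGroup.lift.symm.injective (AddMonoidHom.ext h)

theorem grothendieckAddGroup_lift_of {M G : Type*} [AddCommMonoid M] [AddCommGroup G]
    (f : M →+ G) (m : M) :
    GrothendieckAddGroup.lift f (GrothendieckAddGroup.of m) = f m :=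
  DFunLike.congr_fun (GrothendieckAddGroup.lift.symm_apply_apply f) m

/-- Left multiplication by an element of a semiring on the Grothendieck group. -/
noncomputable def grothendieckMulLeftHom (s : S) :
    GrothendieckAddGroup S →+ GrothendieckAddGroup S :=
  GrothendieckAddGroup.lift (GrothendieckAddGroup.of.comp (AddMonoidHom.mulLeft s))

theorem grothendieckMulLeftHom_of (s m : S) :
    grothendieckMulLeftHom S s (GrothendieckAddGroup.of m) = GrothendieckAddGroup.of (s * m) :=
  grothendieckAddGroup_lift_of _ m

/-- The action of a semiring on its Grothendieck group by left multiplication. -/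
noncomputable def grothendieckMulLeft : S →+* AddMonoid.End (GrothendieckAddGroup S) where
  toFun := grothendieckMulLeftHom S
  map_one' := grothendieckAddGroup_hom_ext fun m => by
    rw [grothendieckMulLeftHom_of, one_mul]
    rfl
  map_mul' s t := grothendieckAddGroup_hom_ext fun m => by
    change _ = grothendieckMulLeftHom S s (grothendieckMulLeftHom S t _)
    rw [grothendieckMulLeftHom_of, grothendieckMulLeftHom_of, grothendieckMulLeftHom_of, mul_assoc]
  map_zero' := grothendieckAddGroup_hom_ext fun m => by
    rw [grothendieckMulLeftHom_of, zero_mul, map_zero]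
    rfl
  map_add' s t := grothendieckAddGroup_hom_ext fun m => by
    change _ = grothendieckMulLeftHom S s _ + grothendieckMulLeftHom S t _
    rw [grothendieckMulLeftHom_of, grothendieckMulLeftHom_of, grothendieckMulLeftHom_of, add_mul,
      map_add]

/-- The ring of differences of a semiring. -/
def differenceRing : Subring (AddMonoid.End (GrothendieckAddGroup S)) where
  carrier := {x | ∃ s t, x = grothendieckMulLeft S s - grothendieckMulLeft S t}
  one_mem' := ⟨1, 0, by simp⟩
  zero_mem' := ⟨0, 0, by simp⟩
  neg_mem' := by
    rintro _ ⟨s, t, rfl⟩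
    exact ⟨t, s, by simp⟩
  add_mem' := by
    rintro _ _ ⟨s, t, rfl⟩ ⟨s', t', rfl⟩
    refine ⟨s + s', t + t', ?_⟩
    rw [map_add, map_add]
    abel
  mul_mem' := by
    rintro _ _ ⟨s, t, rfl⟩ ⟨s', t', rfl⟩
    refine ⟨s * s' + t * t', s * t' + t * s', ?_⟩
    rw [map_add, map_add, map_mul, map_mul, map_mul, map_mul, sub_mul, mul_sub, mul_sub]
    abel

variable {S} in
-- Evaluating at the class of `1` recovers the classes of `s` and `t`, whose equality means equality
-- after adding some element.
theorem exists_add_eq_of_grothendieckMulLeft_eq {s t : S}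
    (h : grothendieckMulLeft S s = grothendieckMulLeft S t) : ∃ k, s + k = t + k := by
  have h₁ := congrArg (fun f => f (GrothendieckAddGroup.of (1 : S))) h
  have h₂ : ∀ s : S, grothendieckMulLeft S s (GrothendieckAddGroup.of (1 : S)) =
      GrothendieckAddGroup.of s := fun s =>
    (grothendieckMulLeftHom_of S s 1).trans (congrArg GrothendieckAddGroup.of (mul_one s))
  rw [h₂, h₂] at h₁
  obtain ⟨c, hc⟩ := (AddLocalization.addMonoidOf (⊤ : AddSubmonoid S)).eq_iff_exists.mp h₁
  exact ⟨c, by rw [add_comm, hc, add_comm]⟩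

end DifferenceRing

/-- Adjoin an identity over `ℕ` and take differences. Since `R` is an ideal of its unitization,
products with elements of `R` have zero `ℕ`-component, so differences from `R` form an ideal. -/
theorem exists_isDifferenceMap (R : Type u) [NonUnitalSemiring R] :
    ∃ (B : Type u) (_ : Ring B) (φ : R →ₙ+* B), IsDifferenceMap φ := by
  let S := Unitization ℕ R
  let φ : R →ₙ+* differenceRing S :=
    { toFun := fun r => ⟨grothendieckMulLeft S (r : S), (r : S), 0, by simp⟩
      map_mul' := fun r s => Subtype.ext <| by
        change grothendieckMulLeft S ((r * s : R) : S) = _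
        rw [Unitization.inr_mul, map_mul]
        rfl
      map_zero' := Subtype.ext <| by
        change grothendieckMulLeft S ((0 : R) : S) = _
        rw [Unitization.inr_zero, map_zero]
        rfl
      map_add' := fun r s => Subtype.ext <| by
        change grothendieckMulLeft S ((r + s : R) : S) = _
        rw [Unitization.inr_add, map_add]
        rfl }
  have hφ : ∀ r, (φ r : AddMonoid.End (Algebra.GrothendieckAddGroup S)) =
    grothendieckMulLeft S (r : S) := fun _ => rfl
  refine ⟨differenceRing S, inferInstance, φ, ?_, ?_, ?_⟩
  · intro r s h
    obtain ⟨k, hk⟩ := exists_add_eq_of_grothendieckMulLeft_eq (congrArg Subtype.val h)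
    exact ⟨k.toProd.2, congrArg (fun x => x.toProd.2) hk⟩
  · rintro r ⟨_, s, t, rfl⟩
    have key : ∀ s : S, (r : S) * s = (((r : S) * s).toProd.2 : S) := fun s => by
      refine Unitization.ext ?_ rfl
      rw [Unitization.fst_mul, Unitization.fst_inr, Unitization.fst_inr, zero_mul]
    refine ⟨((r : S) * s).toProd.2, ((r : S) * t).toProd.2, Subtype.ext ?_⟩
    push_cast
    rw [hφ, hφ, hφ, ← key, ← key, map_mul, map_mul, mul_sub]
  · rintro r ⟨_, s, t, rfl⟩
    have key : ∀ s : S, s * (r : S) = ((s * (r : S)).toProd.2 : S) := fun s => by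
      refine Unitization.ext ?_ rfl
      rw [Unitization.fst_mul, Unitization.fst_inr, Unitization.fst_inr, mul_zero]
    refine ⟨(s * (r : S)).toProd.2, (t * (r : S)).toProd.2, Subtype.ext ?_⟩
    push_cast
    rw [hφ, hφ, hφ, ← key, ← key, map_mul, map_mul, sub_mul]

theorem IsDifferenceMap.matrix {ι : Type} [Fintype ι] [DecidableEq ι] {R : Type u} {B : Type v}
    [NonUnitalSemiring R] [Ring B] {φ : R →ₙ+* B} (h : IsDifferenceMap φ) :
    IsDifferenceMap (matrixMap ι φ) where
  exists_add_eq X Y hXY := by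
    choose k hk using fun i j => h.exists_add_eq (X i j) (Y i j) (congrFun (congrFun hXY i) j)
    exact ⟨Matrix.of k, Matrix.ext hk⟩
  exists_mul_eq X b := by
    choose s t hst using fun i j k => h.exists_mul_eq (X i j) (b j k)
    refine ⟨Matrix.of fun i k => ∑ j, s i j k, Matrix.of fun i k => ∑ j, t i j k, ?_⟩
    ext i k
    simp [Matrix.mul_apply, hst, map_sum]
  exists_mul_eq' X b := by
    choose s t hst using fun i j k => h.exists_mul_eq' (X j k) (b i j)
    refine ⟨Matrix.of fun i k => ∑ j, s i j k, Matrix.of fun i k => ∑ j, t i j k, ?_⟩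
    ext i k
    simp [Matrix.mul_apply, hst, map_sum]

theorem jacobsonRadical_matrix {ι : Type} [Fintype ι] [DecidableEq ι] (R : Type u) [NonUnitalSemiring R] :
    (jacobsonRadical (Matrix ι ι R) : Set (Matrix ι ι R)) =
      (jacobsonRadical R : Set R).matrix := by
  obtain ⟨B, _, φ, h⟩ := exists_isDifferenceMap R
  ext X
  rw [SetLike.mem_coe, h.matrix.mem_jacobsonRadical_iff, ← TwoSidedIdeal.matrix_jacobson_bot,
    TwoSidedIdeal.mem_matrix]
  exact forall₂_congr fun i j => h.mem_jacobsonRadical_iff.symm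

end Hemiring

theorem corollary5p11 {R : Type*} [NonUnitalSemiring R] (n : ℕ) (hn : 1 ≤ n) :
    Hemiring.brownMcCoyRadical (Matrix (Fin n) (Fin n) R) =
        (Hemiring.brownMcCoyRadical R).matrix ∧
      Hemiring.simpleRadical (Matrix (Fin n) (Fin n) R) =
        (Hemiring.simpleRadical R).matrix ∧
      (Hemiring.jacobsonRadical (Matrix (Fin n) (Fin n) R) : Set (Matrix (Fin n) (Fin n) R)) =
        (Hemiring.jacobsonRadical R : Set R).matrix := by
  have : Nonempty (Fin n) := ⟨⟨0, hn⟩⟩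
  exact ⟨Hemiring.brownMcCoyRadical_matrix R, Hemiring.simpleRadical_matrix R,
    Hemiring.jacobsonRadical_matrix R⟩
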